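/- Let $p$ be a prime, $s\ge 1$ an integer, and let $m,n,d$ be integers with $n\ge m\ge d\ge 2$. Write $\mathbb{Z}_{p^s}$ for the ring of integers modulo $p^s$ and $\mathbb{Z}_{p^s}^{m\times n}$ for the set of $m\times n$ matrices over it. The inner rank $\rho(A)$ of a nonzero matrix $A\in\mathbb{Z}_{p^s}^{m\times n}$ is the least positive integer $r$ such that $A=BC$ for some $B\in\mathbb{Z}_{p^s}^{m\times r}$ and $C\in\mathbb{Z}_{p^s}^{r\times n}$, and $\rho(0)=0$. The generalized bilinear forms graph $\Gamma_d(\mathbb{Z}_{p^s}^{m\times n})$ is the simple graph with vertex set $\mathbb{Z}_{p^s}^{m\times n}$ in which two distinct matrices $A$ and $B$ are adjacent if and only if $\rho(A-B)<d$. Then its independence number $\alpha$ (the largest cardinality of a set of pairwise non-adjacent vertices) and its clique number $\omega$ (the largest cardinality of a set of pairwise adjacent vertices) are $$\alpha\bigl(\Gamma_d(\mathbb{Z}_{p^s}^{m\times n})\bigr)=p^{sn(m-d+1)},\qquad \omega\bigl(\Gamma_d(\mathbb{Z}_{p^s}^{m\times n})\bigr)=p^{sn(d-1)}.$$ -/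

import Mathlib

/-- The inner rank of an `m × n` matrix `A` over a commutative ring `R`: the least `r` such that
`A = B * C` with `B` of size `m × r` and `C` of size `r × n`. Such an `r` always exists
(for example `r = n`), and `r = 0` is possible exactly when `A = 0`; so the inner rank of `0` is `0`
and that of a nonzero matrix is the least positive such `r`. -/
noncomputable def innerRank {R : Type*} [CommRing R] {m n : ℕ}
    (A : Matrix (Fin m) (Fin n) R) : ℕ :=
  sInf {r : ℕ | ∃ (B : Matrix (Fin m) (Fin r) R) (C : Matrix (Fin r) (Fin n) R), A = B * C}

theorem innerRank_neg {R : Type*} [CommRing R] {m n : ℕ} (A : Matrix (Fin m) (Fin n) R) :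
    innerRank (-A) = innerRank A := by
  unfold innerRank
  congr 1
  ext r
  constructor
  · rintro ⟨B, C, h⟩
    exact ⟨-B, C, by rw [Matrix.neg_mul, ← h, neg_neg]⟩
  · rintro ⟨B, C, h⟩
    exact ⟨-B, C, by rw [Matrix.neg_mul, ← h]⟩

/-- The generalized bilinear forms graph on the `m × n` matrices over `R`: two distinct matrices
are adjacent when the inner rank of their difference is less than `d`. -/
def bilinearFormsGraph (R : Type*) [CommRing R] (m n d : ℕ) :
    SimpleGraph (Matrix (Fin m) (Fin n) R) where
  Adj A B := A ≠ B ∧ innerRank (A - B) < d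
  symm := ⟨fun A B h => ⟨h.1.symm, by rw [← neg_sub, innerRank_neg]; exact h.2⟩⟩
  loopless := ⟨fun _ h => h.1 rfl⟩

/-!
The graph is a Cayley graph of the additive group of matrices, so the sum map on the product of an
independent set and a clique is injective and `α * ω ≤ p ^ (s * n * m)`
(`bilinearFormsGraph_indep_mul_clique_le`). It therefore suffices to exhibit a clique of size
`p ^ (s * n * (d - 1))` and an independent set of size `p ^ (s * n * (m - d + 1))`, whose product is
exactly this bound. The clique consists of the matrices supported on the first `d - 1` rows.

The independent set is a maximum rank distance code. Over `𝔽_p` this is the Gabidulin code of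
evaluations of linearized polynomials over `𝔽_{p^n}`: every nonzero codeword has rank at least `d`
because a linearized polynomial has few roots (`exists_linearMap_le_rank`). Lift a basis of that
code to integral matrices and take its span modulo `p ^ s`. If a nonzero element had inner rank
`r < d`, then lifting its factorization to `ℤ` and pulling out the power of `p` dividing the
coefficients would give an integral matrix of rank at most `r` that reduces modulo `p` to a nonzero
codeword. This is impossible, since reduction modulo `p` does not increase the rank
(`Matrix.rank_map_intCast_le`, `le_innerRank_of_le_rank`).
-/

/-! ### Rank modulo a prime -/

/-- A matrix of rank at least `d` over a field can be cut down to the `d × d` identity: the columns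
of `A * Q` are `d` independent vectors in the column space of `A`, and `P` is a left inverse of
`A * Q`. -/
theorem Matrix.exists_mul_mul_eq_one_of_le_rank {F : Type*} [Field F] {m n d : ℕ}
    (A : Matrix (Fin m) (Fin n) F) (h : d ≤ A.rank) :
    ∃ (P : Matrix (Fin d) (Fin m) F) (Q : Matrix (Fin n) (Fin d) F), P * A * Q = 1 := by
  obtain ⟨v, hv⟩ := exists_linearIndependent_of_le_finrank h
  choose u hu using fun i => (v i).2
  let Q : Matrix (Fin n) (Fin d) F := Matrix.of fun j i => u i j
  have hAQ : ∀ i, (A * Q).col i = (v i : Fin m → F) := by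
    intro i
    rw [← hu i]
    rfl
  have hli : LinearIndependent F (A * Q).col := by
    have := hv.map' (Submodule.subtype _) (Submodule.ker_subtype _)
    rwa [show (LinearMap.range A.mulVecLin).subtype ∘ v = (A * Q).col from
      (funext hAQ).symm] at this
  have hker : LinearMap.ker (A * Q).mulVecLin = ⊥ :=
    LinearMap.ker_eq_bot.2 (Matrix.mulVec_injective_iff.2 hli)
  obtain ⟨g, hg⟩ := (A * Q).mulVecLin.exists_leftInverse_of_injective hker
  refine ⟨LinearMap.toMatrix' g, Q, ?_⟩
  rw [Matrix.mul_assoc]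
  have := congrArg LinearMap.toMatrix' hg
  rwa [LinearMap.toMatrix'_comp, LinearMap.toMatrix'_id, ← Matrix.toLin'_apply',
    LinearMap.toMatrix'_toLin'] at this

/-- Reduction modulo `p` does not increase the rank: by
`Matrix.exists_mul_mul_eq_one_of_le_rank` there are integral `P`, `Q` with `P * M * Q` congruent to
an identity matrix modulo `p`, and such a square matrix has nonzero determinant over `ℤ`. -/
theorem Matrix.rank_map_intCast_le {p : ℕ} [Fact p.Prime] {m n : ℕ}
    (M : Matrix (Fin m) (Fin n) ℤ) : (M.map (Int.castRingHom (ZMod p))).rank ≤ M.rank := by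
  obtain ⟨P, Q, hPQ⟩ := (M.map (Int.castRingHom (ZMod p))).exists_mul_mul_eq_one_of_le_rank le_rfl
  have hlift : ∀ {a b : ℕ} (X : Matrix (Fin a) (Fin b) (ZMod p)),
      ∃ Y : Matrix (Fin a) (Fin b) ℤ, Y.map (Int.castRingHom (ZMod p)) = X := fun X =>
    ⟨X.map ZMod.cast, by ext; simp⟩
  obtain ⟨P, rfl⟩ := hlift P
  obtain ⟨Q, rfl⟩ := hlift Q
  rw [← Matrix.map_mul, ← Matrix.map_mul] at hPQ
  have hdet : (P * M * Q).det ≠ 0 := by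
    intro h0
    have h1 := congrArg Matrix.det hPQ
    rw [← RingHom.mapMatrix_apply, ← RingHom.map_det, h0] at h1
    simp at h1
  have h1 := Matrix.rank_of_det_ne_zero hdet
  rw [Fintype.card_fin] at h1
  exact h1.symm.le.trans ((Matrix.rank_mul_le_left _ _).trans (Matrix.rank_mul_le_right _ _))

/-! ### Inner rank modulo a prime power -/

theorem exists_mul_eq_innerRank {R : Type*} [CommRing R] {m n : ℕ}
    (A : Matrix (Fin m) (Fin n) R) :
    ∃ (B : Matrix (Fin m) (Fin (innerRank A)) R) (C : Matrix (Fin (innerRank A)) (Fin n) R),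
      A = B * C :=
  Nat.sInf_mem (s := {r | ∃ (B : Matrix (Fin m) (Fin r) R) (C : Matrix (Fin r) (Fin n) R),
    A = B * C}) ⟨n, A, 1, (Matrix.mul_one A).symm⟩

theorem innerRank_le_of_eq_mul {R : Type*} [CommRing R] {m n r : ℕ}
    {A : Matrix (Fin m) (Fin n) R} (B : Matrix (Fin m) (Fin r) R) (C : Matrix (Fin r) (Fin n) R)
    (h : A = B * C) : innerRank A ≤ r :=
  Nat.sInf_le ⟨B, C, h⟩

/-- An integral vector `c` that does not vanish modulo `p ^ s` is `p ^ k • e` with `k < s` and `e`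
nonzero modulo `p`. -/
theorem exists_primitive_part {ι : Type*} {p s : ℕ} {c : ι → ℤ}
    (hc : ∃ j, ¬ (p : ℤ) ^ s ∣ c j) :
    ∃ k < s, ∃ e : ι → ℤ, (∀ i, c i = (p : ℤ) ^ k * e i) ∧ ∃ j, ¬ (p : ℤ) ∣ e j := by
  classical
  induction s with
  | zero => simp at hc
  | succ t ih =>
    by_cases h : ∃ j, ¬ (p : ℤ) ^ t ∣ c j
    · obtain ⟨k, hk, h⟩ := ih h
      exact ⟨k, hk.trans t.lt_succ_self, h⟩
    · push Not at h
      choose e he using h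
      obtain ⟨j, hj⟩ := hc
      refine ⟨t, t.lt_succ_self, e, he, j, fun hd => hj ?_⟩
      rw [he j, pow_succ]
      exact mul_dvd_mul_left _ hd

/-- If all nontrivial `𝔽_p`-combinations of the integral matrices `G i` have rank at least `d`
modulo `p`, then all nontrivial combinations modulo `p ^ s` have inner rank at least `d`. -/
theorem le_innerRank_of_le_rank {p s : ℕ} [Fact p.Prime] {m n d : ℕ} {ι : Type*} [Fintype ι]
    (G : ι → Matrix (Fin m) (Fin n) ℤ)
    (hG : ∀ e : ι → ZMod p, e ≠ 0 →
      d ≤ (∑ i, e i • (G i).map (Int.castRingHom (ZMod p))).rank)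
    {c : ι → ℤ} (hc : ∃ j, ¬ (p : ℤ) ^ s ∣ c j) :
    d ≤ innerRank ((∑ i, c i • G i).map (Int.castRingHom (ZMod (p ^ s)))) := by
  obtain ⟨B, C, hBC⟩ :=
    exists_mul_eq_innerRank ((∑ i, c i • G i).map (Int.castRingHom (ZMod (p ^ s))))
  generalize innerRank ((∑ i, c i • G i).map (Int.castRingHom (ZMod (p ^ s)))) = r at B C hBC ⊢
  have hlift : ∀ {a b : ℕ} (X : Matrix (Fin a) (Fin b) (ZMod (p ^ s))),
      ∃ Y : Matrix (Fin a) (Fin b) ℤ, Y.map (Int.castRingHom (ZMod (p ^ s))) = X := fun X =>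
    ⟨X.map ZMod.cast, by ext; simp⟩
  obtain ⟨B', hB⟩ := hlift B
  obtain ⟨C', hC⟩ := hlift C
  obtain ⟨k, hk, e, he, j, hj⟩ := exists_primitive_part hc
  rw [← hB, ← hC, ← Matrix.map_mul] at hBC
  have hE : ∀ a b, ∃ x, (∑ i, c i • G i) a b - (B' * C') a b = (p : ℤ) ^ s * x := by
    intro a b
    have h := congrFun (congrFun hBC a) b
    simp only [Matrix.map_apply, eq_intCast] at h
    have := (ZMod.intCast_eq_intCast_iff_dvd_sub _ _ _).1 h.symm
    exact_mod_cast this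
  choose E hE using hE
  let M : Matrix (Fin m) (Fin n) ℤ := ∑ i, e i • G i - (p : ℤ) ^ (s - k) • Matrix.of E
  have hp0 : (p : ℤ) ≠ 0 := by exact_mod_cast (Fact.out : p.Prime).ne_zero
  -- over `ℤ` the factorization becomes `p ^ k • M = B' * C'`, with `M` congruent modulo `p`
  -- to the combination with coefficients `e` because `k < s`
  have hM : (p : ℤ) ^ k • M = B' * C' := by
    ext a b
    have h := hE a b
    have hs : (p : ℤ) ^ s = p ^ k * p ^ (s - k) := by rw [← pow_add]; congr 1; omega
    simp only [M, Matrix.smul_apply, Matrix.sub_apply, Matrix.sum_apply, smul_eq_mul, he,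
      Matrix.of_apply, mul_sub, Finset.mul_sum, mul_assoc] at h ⊢
    rw [← mul_assoc, ← hs]
    linarith
  have hMp : M.map (Int.castRingHom (ZMod p))
      = ∑ i, (e i : ZMod p) • (G i).map (Int.castRingHom (ZMod p)) := by
    ext a b
    have : (s - k) ≠ 0 := by omega
    simp [M, Matrix.sum_apply, this]
  have hd : d ≤ (M.map (Int.castRingHom (ZMod p))).rank := by
    rw [hMp]
    refine hG (fun i => (e i : ZMod p)) fun h0 => hj ?_
    exact (ZMod.intCast_zmod_eq_zero_iff_dvd _ _).1 (congrFun h0 j)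
  calc d ≤ M.rank := hd.trans M.rank_map_intCast_le
    _ = ((p : ℤ) ^ k • M).rank :=
      (Matrix.rank_smul_of_mem_nonZeroDivisors M
        (mem_nonZeroDivisors_of_ne_zero (pow_ne_zero k hp0))).symm
    _ = (B' * C').rank := by rw [hM]
    _ ≤ B'.rank := Matrix.rank_mul_le_left _ _
    _ ≤ r := Matrix.rank_le_width _

/-! ### Linearized polynomials and Gabidulin codes -/

open Polynomial in
/-- A nonzero linearized polynomial `∑ i < k, a i * X ^ (q ^ i)` over an extension of `𝔽_q`, viewed as
an `𝔽_q`-linear map, has kernel of dimension less than `k`: it has at most `q ^ (k - 1)` roots. -/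
theorem finrank_ker_linearizedMap_lt {F K : Type*} [Field F] [Fintype F] [Field K] [Algebra F K]
    [Finite K] {k : ℕ} {a : Fin k → K} (ha : a ≠ 0) :
    Module.finrank F (LinearMap.ker (Fintype.linearCombination K
      (fun i : Fin k => (FiniteField.frobeniusAlgHom F K ^ (i : ℕ)).toLinearMap) a)) < k := by
  classical
  set L := Fintype.linearCombination K
      (fun i : Fin k => (FiniteField.frobeniusAlgHom F K ^ (i : ℕ)).toLinearMap) a with hL
  have := Fintype.ofFinite K
  let q := Fintype.card F
  have hq : 1 < q := Fintype.one_lt_card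
  obtain ⟨j, hj⟩ := Function.ne_iff.1 ha
  have hk : 0 < k := j.pos
  let f : K[X] := ∑ i : Fin k, C (a i) * X ^ q ^ (i : ℕ)
  have hf : f ≠ 0 := by
    intro h0
    have h := congrArg (coeff · (q ^ (j : ℕ))) h0
    simp only [f, finsetSum_coeff, coeff_C_mul, coeff_X_pow, coeff_zero] at h
    rw [Finset.sum_eq_single j] at h
    · simp at h; exact hj h
    · intro i _ hij
      rw [if_neg, mul_zero]
      exact fun h => hij (Fin.ext (Nat.pow_right_injective hq h).symm)
    · simp
  have hdeg : f.natDegree ≤ q ^ (k - 1) := by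
    refine natDegree_sum_le_of_forall_le _ _ fun i _ => (natDegree_C_mul_X_pow_le _ _).trans ?_
    exact Nat.pow_le_pow_right hq.le (by omega)
  have heval : ∀ x, f.eval x = L x := by
    intro x
    have hfrob : ∀ i : ℕ, (FiniteField.frobeniusAlgHom F K ^ i) x = x ^ q ^ i := by
      intro i
      rw [AlgHom.coe_pow]
      simp [FiniteField.coe_frobeniusAlgHom, q, pow_iterate]
    simp [f, hL, eval_finsetSum, Fintype.linearCombination_apply, ← hfrob]
  have hcard : Nat.card (LinearMap.ker L) ≤ q ^ (k - 1) := by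
    rw [Nat.card_eq_fintype_card, Fintype.card_subtype]
    refine (card_le_degree_of_subset_roots (p := f) ?_).trans hdeg
    intro x hx
    simp at hx
    rw [mem_roots hf]
    simpa [IsRoot, heval] using hx
  rw [Module.natCard_eq_pow_finrank (K := F), Nat.card_eq_fintype_card] at hcard
  have := (Nat.pow_le_pow_iff_right hq).1 hcard
  omega

/-- The Gabidulin code: an `n * (m - d + 1)`-dimensional space of `m × n` matrices over `𝔽_p`, given
as the image of a linear map `Φ`, all of whose nonzero elements have rank at least `d`. The codeword
of a linearized polynomial with `m - d + 1` coefficients in `𝔽_{p^n}` has as its rows the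
coordinates of the values at `m` fixed elements that are independent over `𝔽_p`. -/
theorem exists_linearMap_le_rank (p : ℕ) [Fact p.Prime] {m n d : ℕ} (hd : 1 ≤ d) (hdm : d ≤ m)
    (hmn : m ≤ n) :
    ∃ Φ : (Fin (n * (m - d + 1)) → ZMod p) →ₗ[ZMod p] Matrix (Fin m) (Fin n) (ZMod p),
      ∀ c ≠ 0, d ≤ (Φ c).rank := by
  let K := GaloisField p n
  have hK : Module.finrank (ZMod p) K = n := GaloisField.finrank p (by omega)
  let b : Module.Basis (Fin n) (ZMod p) K := Module.finBasisOfFinrankEq _ _ hK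
  let S : (Fin (m - d + 1) → K) →ₗ[ZMod p] (K →ₗ[ZMod p] K) :=
    (Fintype.linearCombination K (fun i : Fin (m - d + 1) =>
      (FiniteField.frobeniusAlgHom (ZMod p) K ^ (i : ℕ)).toLinearMap)).restrictScalars (ZMod p)
  let g : (Fin m → ZMod p) →ₗ[ZMod p] K :=
    Fintype.linearCombination (ZMod p) (b ∘ Fin.castLE hmn)
  have hg : Function.Injective g :=
    (b.linearIndependent.comp _ (Fin.castLE_injective hmn)).fintypeLinearCombination_injective
  let ε : (Fin (n * (m - d + 1)) → ZMod p) ≃ₗ[ZMod p] (Fin (m - d + 1) → K) :=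
    LinearEquiv.ofFinrankEq _ _ (by
      have h := Module.finrank_pi_fintype (ZMod p) (M := fun _ : Fin (m - d + 1) => K)
      rw [h, hK]
      simp [mul_comm])
  let Φ : (Fin (n * (m - d + 1)) → ZMod p) →ₗ[ZMod p] Matrix (Fin m) (Fin n) (ZMod p) :=
    { toFun := fun c => (LinearMap.toMatrix' (b.equivFun.toLinearMap ∘ₗ S (ε c) ∘ₗ g)).transpose
      map_add' := fun x y => by
        rw [map_add, map_add, LinearMap.add_comp, LinearMap.comp_add, map_add,
          Matrix.transpose_add]
      map_smul' := fun t x => by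
        rw [map_smul, map_smul, LinearMap.smul_comp, LinearMap.comp_smul, map_smul,
          Matrix.transpose_smul, RingHom.id_apply] }
  refine ⟨Φ, fun c hc => ?_⟩
  have hlt : Module.finrank (ZMod p) (LinearMap.ker (S (ε c))) < m - d + 1 :=
    finrank_ker_linearizedMap_lt (by simpa using hc)
  set T := b.equivFun.toLinearMap ∘ₗ S (ε c) ∘ₗ g with hT
  have hker : Module.finrank (ZMod p) (LinearMap.ker T)
      ≤ Module.finrank (ZMod p) (LinearMap.ker (S (ε c))) := by
    have hm : ∀ x : LinearMap.ker T, g x ∈ LinearMap.ker (S (ε c)) := by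
      rintro ⟨x, hx⟩
      simpa [hT] using hx
    refine LinearMap.finrank_le_finrank_of_injective
      (f := (g ∘ₗ (LinearMap.ker T).subtype).codRestrict _ hm) ?_
    intro x y hxy
    exact Subtype.ext (hg (congrArg Subtype.val hxy))
  have hrn := T.finrank_range_add_finrank_ker
  rw [Module.finrank_fin_fun] at hrn
  have hrank : (Φ c).rank = Module.finrank (ZMod p) (LinearMap.range T) := by
    change (LinearMap.toMatrix' T).transpose.rank = _
    rw [Matrix.rank_transpose, Matrix.rank, ← Matrix.toLin'_apply', Matrix.toLin'_toMatrix']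
  omega

/-! ### Cliques and independent sets of the bilinear forms graph -/

theorem Matrix.natCard_fin {R : Type*} {m n : ℕ} :
    Nat.card (Matrix (Fin m) (Fin n) R) = Nat.card R ^ (n * m) := by
  change Nat.card (Fin m → Fin n → R) = _
  rw [Nat.card_fun, Nat.card_fun, Nat.card_fin, Nat.card_fin, pow_mul]

/-- The clique–coclique bound. Adjacency depends only on the difference of two matrices, so for an
independent set `S` and a clique `T` the addition map `S × T → R^{m × n}` is injective. -/
theorem bilinearFormsGraph_indep_mul_clique_le {R : Type*} [CommRing R] [Finite R] {m n d : ℕ} :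
    (bilinearFormsGraph R m n d).indepNum * (bilinearFormsGraph R m n d).cliqueNum
      ≤ Nat.card R ^ (n * m) := by
  classical
  have := Fintype.ofFinite R
  obtain ⟨S, hS⟩ := (bilinearFormsGraph R m n d).exists_isNIndepSet_indepNum
  obtain ⟨T, hT⟩ := (bilinearFormsGraph R m n d).exists_isNClique_cliqueNum
  rw [← hS.card_eq, ← hT.card_eq, ← Finset.card_product]
  rw [← Matrix.natCard_fin, Nat.card_eq_fintype_card, ← Finset.card_univ]
  refine Finset.card_le_card_of_injOn (fun x => x.1 + x.2) (t := Finset.univ) (by simp) ?_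
  rintro ⟨a, b⟩ hab ⟨a', b'⟩ hab' h
  simp only [Finset.coe_product, Set.mem_prod, Finset.mem_coe] at hab hab' h
  have hsub : a - a' = b' - b := by
    rw [sub_eq_sub_iff_add_eq_add, h, add_comm]
  by_cases hb : b = b'
  · subst hb
    rw [add_right_cancel h]
  · have hadj := hT.isClique hab'.2 hab.2 (Ne.symm hb)
    have ha : a ≠ a' := fun h0 => hb (by
      rw [h0, sub_self] at hsub
      exact (sub_eq_zero.1 hsub.symm).symm)
    exact absurd ⟨ha, hsub ▸ hadj.2⟩ (hS.isIndepSet hab.1 hab'.1 ha)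

/-- The matrices supported on the first `d - 1` rows form a clique. -/
theorem pow_le_bilinearFormsGraph_cliqueNum {R : Type*} [CommRing R] [Finite R] {m n d : ℕ}
    (hd : 1 ≤ d) (hdm : d ≤ m) :
    Nat.card R ^ (n * (d - 1)) ≤ (bilinearFormsGraph R m n d).cliqueNum := by
  classical
  have := Fintype.ofFinite R
  have hle : d - 1 ≤ m := by omega
  -- Left multiplication by `J` appends zero rows.
  let J : Matrix (Fin m) (Fin (d - 1)) R :=
    (1 : Matrix (Fin m) (Fin m) R).submatrix id (Fin.castLE hle)
  let f : Matrix (Fin (d - 1)) (Fin n) R → Matrix (Fin m) (Fin n) R := fun X => J * X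
  have hf : Function.Injective f := by
    intro X Y h
    ext i j
    have := congrFun (congrFun h (Fin.castLE hle i)) j
    simpa [f, J, Matrix.mul_apply, Matrix.one_apply, (Fin.castLE_injective hle).eq_iff] using this
  have hcl : (bilinearFormsGraph R m n d).IsClique
      (Finset.univ.map ⟨f, hf⟩ : Finset (Matrix (Fin m) (Fin n) R)) := by
    intro A hA B hB hAB
    obtain ⟨X, -, rfl⟩ := Finset.mem_map.1 hA
    obtain ⟨Y, -, rfl⟩ := Finset.mem_map.1 hB
    have := innerRank_le_of_eq_mul (A := f X - f Y) J (X - Y) (Matrix.mul_sub _ _ _).symm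
    exact ⟨hAB, by change innerRank (f X - f Y) < d; omega⟩
  refine le_trans (le_of_eq ?_) (SimpleGraph.IsClique.card_le_cliqueNum (tc := hcl))
  rw [Finset.card_map, Finset.card_univ, ← Nat.card_eq_fintype_card, Matrix.natCard_fin]

/-- The reduction modulo `p ^ s` of an integral lift of a basis of the Gabidulin code spans a free
module of rank `n * (m - d + 1)`, which is an independent set. -/
theorem pow_le_bilinearFormsGraph_indepNum {p : ℕ} [Fact p.Prime] (s : ℕ) {m n d : ℕ}
    (hd : 1 ≤ d) (hdm : d ≤ m) (hmn : m ≤ n) :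
    p ^ (s * n * (m - d + 1)) ≤ (bilinearFormsGraph (ZMod (p ^ s)) m n d).indepNum := by
  classical
  have hp0 : NeZero (p ^ s) := ⟨pow_ne_zero s (Fact.out : p.Prime).ne_zero⟩
  obtain ⟨Φ, hΦ⟩ := exists_linearMap_le_rank p hd hdm hmn
  let G : Fin (n * (m - d + 1)) → Matrix (Fin m) (Fin n) ℤ :=
    fun i => (Φ (Pi.single i 1)).map ZMod.cast
  have hG : ∀ e : Fin (n * (m - d + 1)) → ZMod p, e ≠ 0 →
      d ≤ (∑ i, e i • (G i).map (Int.castRingHom (ZMod p))).rank := by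
    intro e he
    have hGi : ∀ i, (G i).map (Int.castRingHom (ZMod p)) = Φ (Pi.single i 1) := fun i => by
      ext; simp [G]
    simp only [hGi]
    have hsum : ∑ i, e i • Φ (Pi.single i 1) = Φ e := by
      simp only [← map_smul, ← map_sum]
      congr 1
      ext j
      simp [Finset.sum_apply, Pi.single_apply]
    rw [hsum]
    exact hΦ e he
  let f : (Fin (n * (m - d + 1)) → ZMod (p ^ s)) → Matrix (Fin m) (Fin n) (ZMod (p ^ s)) :=
    fun c => (∑ i, ((c i).cast : ℤ) • G i).map (Int.castRingHom (ZMod (p ^ s)))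
  have hdist : ∀ x y, x ≠ y → d ≤ innerRank (f x - f y) := by
    intro x y hxy
    obtain ⟨j, hj⟩ := Function.ne_iff.1 hxy
    have := le_innerRank_of_le_rank (s := s) G hG
      (c := fun i => ((x i).cast - (y i).cast : ℤ)) ⟨j, fun h => hj ?_⟩
    · convert this using 2
      ext a b
      simp [f, Matrix.sum_apply, sub_mul, Finset.sum_sub_distrib]
    · have h' := (ZMod.intCast_zmod_eq_zero_iff_dvd ((x j).cast - (y j).cast) (p ^ s)).2
        (by exact_mod_cast h)
      simpa [sub_eq_zero] using h'
  -- Two parameters with the same image would give `0` inner rank at least `d ≥ 1`.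
  have hf : Function.Injective f := by
    intro x y h
    by_contra hxy
    have h0 := hdist x y hxy
    rw [h, sub_self] at h0
    have := innerRank_le_of_eq_mul (A := (0 : Matrix (Fin m) (Fin n) (ZMod (p ^ s)))) (r := 0)
      0 0 (by simp)
    omega
  have hind : (bilinearFormsGraph (ZMod (p ^ s)) m n d).IsIndepSet
      (Finset.univ.map ⟨f, hf⟩ : Finset (Matrix (Fin m) (Fin n) (ZMod (p ^ s)))) := by
    intro A hA B hB hAB hadj
    obtain ⟨X, -, rfl⟩ := Finset.mem_map.1 hA
    obtain ⟨Y, -, rfl⟩ := Finset.mem_map.1 hB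
    exact absurd hadj.2 (not_lt.2 (hdist X Y fun h => hAB (by rw [h])))
  refine le_trans (le_of_eq ?_) hind.card_le_indepNum
  simp [← pow_mul, mul_assoc, ZMod.card]

theorem theorem3p3 (p s m n d : ℕ) (hp : p.Prime) (hs : 1 ≤ s)
    (hd : 2 ≤ d) (hdm : d ≤ m) (hmn : m ≤ n) :
    (bilinearFormsGraph (ZMod (p ^ s)) m n d).indepNum = p ^ (s * n * (m - d + 1)) ∧
      (bilinearFormsGraph (ZMod (p ^ s)) m n d).cliqueNum = p ^ (s * n * (d - 1)) := by
  have : Fact p.Prime := ⟨hp⟩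
  have : NeZero (p ^ s) := ⟨pow_ne_zero s hp.ne_zero⟩
  have hα := pow_le_bilinearFormsGraph_indepNum (p := p) s (by omega : 1 ≤ d) hdm hmn
  have hω := pow_le_bilinearFormsGraph_cliqueNum (R := ZMod (p ^ s)) (n := n)
    (by omega : 1 ≤ d) hdm
  have hαω := bilinearFormsGraph_indep_mul_clique_le (R := ZMod (p ^ s)) (m := m) (n := n) (d := d)
  rw [Nat.card_zmod, ← pow_mul, ← mul_assoc] at hω
  have hV : (p ^ s) ^ (n * m) = p ^ (s * n * (m - d + 1)) * p ^ (s * n * (d - 1)) := by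
    have : m = (m - d + 1) + (d - 1) := by omega
    rw [← pow_mul, ← pow_add, ← mul_add, ← this]
    ring_nf
  rw [Nat.card_zmod, hV] at hαω
  have hα0 : 0 < p ^ (s * n * (m - d + 1)) := pow_pos hp.pos _
  have hω0 : 0 < p ^ (s * n * (d - 1)) := pow_pos hp.pos _
  constructor
  · refine le_antisymm (Nat.le_of_mul_le_mul_right ?_ hω0) hα
    exact (Nat.mul_le_mul_left _ hω).trans hαω
  · refine le_antisymm (Nat.le_of_mul_le_mul_left ?_ hα0) hω
    exact (Nat.mul_le_mul_right _ hα).trans hαω
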